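/- Let $n$ be a positive integer and let $f\colon\{0,1\}^n\to\{0,1\}$ be a Boolean function. A real polynomial in $X_1,\dots,X_n$ is called multilinear if it has the form $\sum_{S\subseteq[n]}c_S\prod_{i\in S}X_i$; the degree of a polynomial is its total degree, and the zero polynomial is given degree $0$. Write $\neg f$ for the function $x\mapsto 1-f(x)$ and define: - $\deg(f)$, the degree of the unique multilinear $p\in\mathbb{R}[X_1,\dots,X_n]$ with $p(x)=f(x)$ for all $x\in\{0,1\}^n$; - $\mathrm{ndeg}(f)$, the minimum of $\deg(p)$ over all multilinear $p\in\mathbb{R}[X_1,\dots,X_n]$ such that, for all $x\in\{0,1\}^n$, $p(x)\neq 0$ if and only if $f(x)=1$; - $\mathrm{rdeg}(f)$, the minimum of $\max(\deg(p),\deg(q))$ over all pairs of multilinear $p,q\in\mathbb{R}[X_1,\dots,X_n]$ such that, for all $x\in\{0,1\}^n$, $q(x)\neq 0$ and $p(x)/q(x)=f(x)$; - $D(f)$, the minimum depth of a deterministic decision tree that queries bits of the input $x$ and outputs $f(x)$ at the leaf reached, for every $x\in\{0,1\}^n$. Then $$\deg(f)\;\le\; D(f)\;\le\; 2\,\mathrm{ndeg}(f)^2\,\mathrm{ndeg}(\neg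 f)^2\;\le\; 2\,\mathrm{rdeg}(f)^4 .$$ -/

import Mathlib

/-! Complexity measures of Boolean functions `f : {0,1}^n → {0,1}`, with `{0,1}` modelled by `Bool`
(`false` is `0`, `true` is `1`). -/

namespace BoolFun

/-- The real number `0` or `1` that a bit stands for. -/
def bit (b : Bool) : ℝ := if b then 1 else 0

/-- The value `p(x)` of a real polynomial at a point of the Boolean cube. -/
noncomputable def evalCube {n : ℕ} (p : MvPolynomial (Fin n) ℝ) (x : Fin n → Bool) : ℝ :=
  MvPolynomial.eval (fun i => bit (x i)) p

/-- `p` is multilinear: every variable has exponent at most one in every monomial of `p`. -/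
def IsMultilinear {n : ℕ} (p : MvPolynomial (Fin n) ℝ) : Prop :=
  ∀ m ∈ p.support, ∀ i, m i ≤ 1

theorem isMultilinear_iff_degreeOf {n : ℕ} (p : MvPolynomial (Fin n) ℝ) :
    IsMultilinear p ↔ ∀ i, MvPolynomial.degreeOf i p ≤ 1 := by
  simp only [IsMultilinear, MvPolynomial.degreeOf_le_iff]
  exact ⟨fun h i m hm => h m hm i, fun h m hm i => h i m hm⟩

/-- The multilinear polynomial with value `1` at `a` and value `0` at all other points of the
cube. -/
noncomputable def indicatorPoly {n : ℕ} (a : Fin n → Bool) : MvPolynomial (Fin n) ℝ :=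
  ∏ i, (if a i then MvPolynomial.X i else 1 - MvPolynomial.X i)

theorem evalCube_indicatorPoly {n : ℕ} (a x : Fin n → Bool) :
    evalCube (indicatorPoly a) x = if x = a then 1 else 0 := by
  unfold evalCube indicatorPoly
  rw [map_prod]
  split_ifs with h
  · subst h
    refine Finset.prod_eq_one fun i _ => ?_
    cases hx : x i <;> simp [bit, hx]
  · obtain ⟨i, hi⟩ := Function.ne_iff.1 h
    refine Finset.prod_eq_zero (Finset.mem_univ i) ?_
    cases hx : x i <;> cases ha : a i <;> simp_all [bit]

theorem degreeOf_indicatorPoly_le {n : ℕ} (a : Fin n → Bool) (j : Fin n) :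
    MvPolynomial.degreeOf j (indicatorPoly a) ≤ 1 := by
  unfold indicatorPoly
  refine (MvPolynomial.degreeOf_prod_le j Finset.univ _).trans ?_
  have key : ∀ i, MvPolynomial.degreeOf j
      (if a i then MvPolynomial.X i else 1 - MvPolynomial.X i : MvPolynomial (Fin n) ℝ)
        ≤ if j = i then 1 else 0 := by
    intro i
    have hX : MvPolynomial.degreeOf j (MvPolynomial.X i : MvPolynomial (Fin n) ℝ)
        = if j = i then 1 else 0 := MvPolynomial.degreeOf_X j i
    split_ifs at hX ⊢ with h1 h2 h2
    all_goals first
      | exact hX.le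
      | (refine (MvPolynomial.degreeOf_sub_le j _ _).trans ?_
         rw [hX, MvPolynomial.degreeOf_one]
         simp)
  refine (Finset.sum_le_sum fun i _ => key i).trans ?_
  simp

/-- Every real function on the Boolean cube is represented by exactly one multilinear
polynomial. -/
theorem existsUnique_multilinear {n : ℕ} (g : (Fin n → Bool) → ℝ) :
    ∃! p : MvPolynomial (Fin n) ℝ, IsMultilinear p ∧ ∀ x, evalCube p x = g x := by
  refine ⟨∑ a, MvPolynomial.C (g a) * indicatorPoly a, ⟨?_, ?_⟩, ?_⟩
  · rw [isMultilinear_iff_degreeOf]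
    intro i
    refine (MvPolynomial.degreeOf_sum_le i _ _).trans (Finset.sup_le fun a _ => ?_)
    exact (MvPolynomial.degreeOf_C_mul_le _ i _).trans (degreeOf_indicatorPoly_le a i)
  · intro x
    have h : ∀ a, MvPolynomial.eval (fun i => bit (x i)) (indicatorPoly a)
        = if x = a then 1 else 0 := fun a => evalCube_indicatorPoly a x
    simp [evalCube, h]
  · rintro p ⟨hp, hpe⟩
    rw [← sub_eq_zero]
    set r : MvPolynomial (Fin n) ℝ := ∑ a, MvPolynomial.C (g a) * indicatorPoly a with hr
    have hre : ∀ x, evalCube r x = g x := by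
      intro x
      have h : ∀ a, MvPolynomial.eval (fun i => bit (x i)) (indicatorPoly a)
          = if x = a then 1 else 0 := fun a => evalCube_indicatorPoly a x
      simp [hr, evalCube, h]
    refine MvPolynomial.eq_zero_of_eval_zero_at_prod_finset _ (fun _ => ({0, 1} : Finset ℝ))
      (fun i => ?_) (fun v hv => ?_)
    · have h1 := (isMultilinear_iff_degreeOf p).1 hp i
      have h2 : MvPolynomial.degreeOf i r ≤ 1 :=
        (MvPolynomial.degreeOf_sum_le i _ _).trans (Finset.sup_le fun a _ =>
          (MvPolynomial.degreeOf_C_mul_le _ i _).trans (degreeOf_indicatorPoly_le a i))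
      have h3 := MvPolynomial.degreeOf_sub_le i p r
      have h4 : ({0, 1} : Finset ℝ).card = 2 := by simp
      rw [h4]
      omega
    · have hv' : v = fun i => bit (decide (v i = 1)) := by
        funext i
        have := hv i
        simp only [Finset.mem_insert, Finset.mem_singleton] at this
        rcases this with h | h <;> simp [h, bit]
      rw [hv', map_sub]
      exact sub_eq_zero.2 ((hpe _).trans (hre _).symm)

/-- The unique multilinear real polynomial that agrees with `f` on the cube. -/
noncomputable def multilinearRep {n : ℕ} (f : (Fin n → Bool) → Bool) : MvPolynomial (Fin n) ℝ :=
  (existsUnique_multilinear fun x => bit (f x)).choose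

theorem multilinearRep_spec {n : ℕ} (f : (Fin n → Bool) → Bool) :
    IsMultilinear (multilinearRep f) ∧ ∀ x, evalCube (multilinearRep f) x = bit (f x) :=
  (existsUnique_multilinear fun x => bit (f x)).choose_spec.1

/-- The degree `deg(f)`. -/
noncomputable def deg {n : ℕ} (f : (Fin n → Bool) → Bool) : ℕ :=
  (multilinearRep f).totalDegree

/-- `p / q` is a rational representation of `f`. -/
def IsRationalRep {n : ℕ} (f : (Fin n → Bool) → Bool) (p q : MvPolynomial (Fin n) ℝ) : Prop :=
  IsMultilinear p ∧ IsMultilinear q ∧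
    ∀ x, evalCube q x ≠ 0 ∧ evalCube p x / evalCube q x = bit (f x)

theorem isRationalRep_multilinearRep_one {n : ℕ} (f : (Fin n → Bool) → Bool) :
    IsRationalRep f (multilinearRep f) 1 := by
  refine ⟨(multilinearRep_spec f).1, ?_, fun x => ?_⟩
  · rw [isMultilinear_iff_degreeOf]
    intro i
    simp [MvPolynomial.degreeOf_one]
  · simp [evalCube, ← (multilinearRep_spec f).2 x]

/-- The rational degree `rdeg(f)`: the least `max (deg p) (deg q)` over all rational
representations `p / q` of `f`. -/
noncomputable def rdeg {n : ℕ} (f : (Fin n → Bool) → Bool) : ℕ :=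
  sInf {d | ∃ p q, IsRationalRep f p q ∧ max p.totalDegree q.totalDegree = d}

/-- The minimum in the definition of `rdeg` is attained. -/
theorem exists_rdeg {n : ℕ} (f : (Fin n → Bool) → Bool) :
    ∃ p q, IsRationalRep f p q ∧ max p.totalDegree q.totalDegree = rdeg f :=
  Nat.sInf_mem (s := {d | ∃ p q, IsRationalRep f p q ∧ max p.totalDegree q.totalDegree = d})
    ⟨_, _, _, isRationalRep_multilinearRep_one f, rfl⟩

/-- `p` is a nondeterministic representation of `f`. -/
def IsNondetRep {n : ℕ} (f : (Fin n → Bool) → Bool) (p : MvPolynomial (Fin n) ℝ) : Prop :=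
  IsMultilinear p ∧ ∀ x, evalCube p x ≠ 0 ↔ f x = true

theorem isNondetRep_multilinearRep {n : ℕ} (f : (Fin n → Bool) → Bool) :
    IsNondetRep f (multilinearRep f) := by
  refine ⟨(multilinearRep_spec f).1, fun x => ?_⟩
  rw [(multilinearRep_spec f).2 x]
  cases f x <;> simp [bit]

/-- The nondeterministic degree `ndeg(f)`: the least degree of a nondeterministic representation
of `f`. -/
noncomputable def ndeg {n : ℕ} (f : (Fin n → Bool) → Bool) : ℕ :=
  sInf {d | ∃ p, IsNondetRep f p ∧ p.totalDegree = d}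

/-- The minimum in the definition of `ndeg` is attained. -/
theorem exists_ndeg {n : ℕ} (f : (Fin n → Bool) → Bool) :
    ∃ p, IsNondetRep f p ∧ p.totalDegree = ndeg f :=
  Nat.sInf_mem (s := {d | ∃ p, IsNondetRep f p ∧ p.totalDegree = d})
    ⟨_, _, isNondetRep_multilinearRep f, rfl⟩

/-- The negation `¬f`. -/
def neg {n : ℕ} (f : (Fin n → Bool) → Bool) : (Fin n → Bool) → Bool := fun x => !f x

/-- Deterministic decision trees on `n` input bits. A leaf outputs a bit; an inner node
`query i t₀ t₁` reads the `i`-th input bit and continues with `t₀` if it is `0` and with `t₁` if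
it is `1`. -/
inductive DecisionTree (n : ℕ) : Type
  | leaf (b : Bool) : DecisionTree n
  | query (i : Fin n) (t₀ t₁ : DecisionTree n) : DecisionTree n

/-- The output of a decision tree on an input. -/
def DecisionTree.eval {n : ℕ} : DecisionTree n → (Fin n → Bool) → Bool
  | .leaf b, _ => b
  | .query i t₀ t₁, x => if x i then t₁.eval x else t₀.eval x

/-- The depth of a decision tree: the largest number of queries on a path from the root to a
leaf. -/
def DecisionTree.depth {n : ℕ} : DecisionTree n → ℕ
  | .leaf _ => 0
  | .query _ t₀ t₁ => max t₀.depth t₁.depth + 1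

/-- The decision tree complexity `D(f)`: the least depth of a decision tree that computes `f`. -/
noncomputable def D {n : ℕ} (f : (Fin n → Bool) → Bool) : ℕ :=
  sInf {d | ∃ T : DecisionTree n, (∀ x, T.eval x = f x) ∧ T.depth = d}

theorem exists_decisionTree_of_dependsOn {n : ℕ} (s : Finset (Fin n)) :
    ∀ f : (Fin n → Bool) → Bool, (∀ x y, (∀ i ∈ s, x i = y i) → f x = f y) →
      ∃ T : DecisionTree n, ∀ x, T.eval x = f x := by
  induction s using Finset.induction_on with
  | empty =>
    intro f hf
    exact ⟨.leaf (f fun _ => false), fun x => hf _ _ (by simp)⟩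
  | insert i s _ ih =>
    intro f hf
    have h : ∀ b, ∃ T : DecisionTree n, ∀ x, T.eval x = f (Function.update x i b) := by
      intro b
      refine ih (fun x => f (Function.update x i b)) fun x y hxy => hf _ _ fun j hj => ?_
      by_cases hji : j = i
      · subst hji
        simp
      · simpa [hji] using hxy j (Finset.mem_of_mem_insert_of_ne hj hji)
    obtain ⟨T₀, h₀⟩ := h false
    obtain ⟨T₁, h₁⟩ := h true
    refine ⟨.query i T₀ T₁, fun x => ?_⟩
    cases hx : x i
    · have hu : Function.update x i false = x := by rw [← hx, Function.update_eq_self]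
      simp [DecisionTree.eval, hx, h₀, hu]
    · have hu : Function.update x i true = x := by rw [← hx, Function.update_eq_self]
      simp [DecisionTree.eval, hx, h₁, hu]

/-- The minimum in the definition of `D` is attained. -/
theorem exists_D {n : ℕ} (f : (Fin n → Bool) → Bool) :
    ∃ T : DecisionTree n, (∀ x, T.eval x = f x) ∧ T.depth = D f := by
  obtain ⟨T, hT⟩ := exists_decisionTree_of_dependsOn Finset.univ f fun x y h =>
    congrArg f (funext fun i => h i (Finset.mem_univ i))
  exact Nat.sInf_mem
    (s := {d | ∃ T : DecisionTree n, (∀ x, T.eval x = f x) ∧ T.depth = d}) ⟨_, T, hT, rfl⟩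

end BoolFun

/-! The middle inequality carries the content. Let `g` and `h` be nondeterministic representations
of `f` and `¬f`, of degrees `d` and `e`. A top-degree monomial `M` of `g` keeps its coefficient on
every subcube with free coordinates `M`, so `g` is nonzero somewhere there
(`exists_ne_zero_of_coeff_ne_zero`); at such a point `f = 1`, hence `h = 0`. Starting where `|h|` is
maximal, each of a family of disjoint top monomials thus gives a block of bits whose change kills
`h`. Using one bit per block and averaging over independent biased bits turns `h` into a univariate
polynomial of degree at most `e`, bounded by 1 on `[0, 1]`, whose slope at 0 is minus the number of
blocks. Markov's inequality allows at most `2e²` blocks (`card_le_of_pairwiseDisjoint`).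

Querying all variables of a maximal disjoint family costs at most `2e²d` and lowers the degree of
`g`; `exists_decisionTree_depth_le` iterates this. The outer inequalities are algebra: a tree of
depth `k` is a polynomial of degree at most `k`, and `p`, `q - p` represent `f`, `¬f` when `p / q =
f`. -/

namespace BoolFun

open Polynomial

/-! ### Functions of bounded degree on the cube -/

section LowDegree

variable {ι κ : Type*}

/-- The function `x ↦ ∏ i ∈ S, xᵢ` on the cube. -/
noncomputable def monomialFun (S : Finset ι) (x : ι → Bool) : ℝ := ∏ i ∈ S, bit (x i)

/-- The functions on the cube that are combinations of monomials of degree at most `d`. -/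
noncomputable def lowDegree (ι : Type*) (d : ℕ) : Submodule ℝ ((ι → Bool) → ℝ) :=
  Submodule.span ℝ (monomialFun '' {S : Finset ι | S.card ≤ d})

theorem monomialFun_mem_lowDegree {S : Finset ι} {d : ℕ} (h : S.card ≤ d) :
    monomialFun S ∈ lowDegree ι d :=
  Submodule.subset_span ⟨S, h, rfl⟩

theorem lowDegree_mono {d e : ℕ} (h : d ≤ e) : lowDegree ι d ≤ lowDegree ι e :=
  Submodule.span_mono (Set.image_mono fun _ hS => le_trans hS h)

theorem const_mem_lowDegree (r : ℝ) (d : ℕ) : (fun _ => r) ∈ lowDegree ι d := by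
  have h : (fun _ : ι → Bool => r) = r • monomialFun (∅ : Finset ι) := by
    funext x; simp [monomialFun]
  rw [h]
  exact Submodule.smul_mem _ _ (monomialFun_mem_lowDegree (by simp))

theorem bit_mem_lowDegree (i : ι) : (fun x : ι → Bool => bit (x i)) ∈ lowDegree ι 1 := by
  have h : (fun x : ι → Bool => bit (x i)) = monomialFun {i} := by
    funext x; simp [monomialFun]
  rw [h]
  exact monomialFun_mem_lowDegree (by simp)

/-- Bits are idempotent, so no separate multilinear reduction of products is needed. -/
theorem monomialFun_mul [DecidableEq ι] (S T : Finset ι) :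
    monomialFun S * monomialFun T = monomialFun (S ∪ T) := by
  funext x
  have aux : ∀ U : Finset ι, monomialFun U x = if ∀ i ∈ U, x i = true then 1 else 0 := by
    intro U
    unfold monomialFun
    split_ifs with h
    · exact Finset.prod_eq_one fun i hi => by simp [h i hi, bit]
    · push Not at h
      obtain ⟨i, hi, hx⟩ := h
      exact Finset.prod_eq_zero hi (by simp [bit, hx])
  simp only [Pi.mul_apply, aux, Finset.mem_union, or_imp, forall_and]
  split_ifs <;> simp_all

theorem mul_mem_lowDegree {a b : ℕ} {g h : (ι → Bool) → ℝ} (hg : g ∈ lowDegree ι a)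
    (hh : h ∈ lowDegree ι b) : g * h ∈ lowDegree ι (a + b) := by
  classical
  have : lowDegree ι a * lowDegree ι b ≤ lowDegree ι (a + b) := by
    unfold lowDegree
    rw [Submodule.span_mul_span]
    refine Submodule.span_mono ?_
    rintro _ ⟨_, ⟨S, hS, rfl⟩, _, ⟨T, hT, rfl⟩, rfl⟩
    exact ⟨S ∪ T, (Finset.card_union_le S T).trans (add_le_add hS hT), (monomialFun_mul S T).symm⟩
  exact this (Submodule.mul_mem_mul hg hh)

theorem prod_mem_lowDegree (S : Finset κ) (d : κ → ℕ) (g : κ → (ι → Bool) → ℝ)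
    (h : ∀ k ∈ S, g k ∈ lowDegree ι (d k)) : ∏ k ∈ S, g k ∈ lowDegree ι (∑ k ∈ S, d k) := by
  classical
  induction S using Finset.induction_on with
  | empty => exact const_mem_lowDegree 1 0
  | insert k S hk ih =>
    rw [Finset.prod_insert hk, Finset.sum_insert hk]
    exact mul_mem_lowDegree (h k (by simp)) (ih fun l hl => h l (by simp [hl]))

theorem monomialFun_comp (S : Finset ι) (φ : (κ → Bool) → ι → Bool) :
    (fun y => monomialFun S (φ y)) = ∏ i ∈ S, fun y => bit (φ y i) := by
  funext y
  simp [monomialFun, Finset.prod_apply]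

theorem comp_mem_lowDegree {d : ℕ} {g : (ι → Bool) → ℝ} (hg : g ∈ lowDegree ι d)
    (φ : (κ → Bool) → ι → Bool) (hφ : ∀ i, (fun y => bit (φ y i)) ∈ lowDegree κ 1) :
    (fun y => g (φ y)) ∈ lowDegree κ d := by
  induction hg using Submodule.span_induction with
  | mem g hg =>
    obtain ⟨S, hS, rfl⟩ := hg
    rw [monomialFun_comp]
    refine lowDegree_mono ?_ (prod_mem_lowDegree S (fun _ => 1) _ fun i _ => hφ i)
    simpa using hS
  | zero => exact const_mem_lowDegree 0 d
  | add g h _ _ ihg ihh => exact add_mem ihg ihh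
  | smul r g _ ih => exact Submodule.smul_mem _ r ih

theorem exists_coeff_of_mem_lowDegree [Fintype ι] {d : ℕ} {g : (ι → Bool) → ℝ}
    (hg : g ∈ lowDegree ι d) : ∃ c : Finset ι → ℝ, (∀ S, d < S.card → c S = 0) ∧
      ∀ x, g x = ∑ S, c S * monomialFun S x := by
  classical
  induction hg using Submodule.span_induction with
  | mem g hg =>
    obtain ⟨S, hS, rfl⟩ := hg
    refine ⟨Pi.single S 1, fun T hT => ?_, fun x => ?_⟩
    · refine Pi.single_eq_of_ne ?_ 1
      rintro rfl
      exact absurd hS (not_le.2 hT)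
    · simp [Pi.single_apply]
  | zero => exact ⟨0, by simp⟩
  | add g h _ _ ihg ihh =>
    obtain ⟨c, hc, hg⟩ := ihg
    obtain ⟨b, hb, hh⟩ := ihh
    exact ⟨c + b, fun S hS => by simp [hc S hS, hb S hS], fun x => by
      simp [hg, hh, add_mul, Finset.sum_add_distrib]⟩
  | smul r g _ ih =>
    obtain ⟨c, hc, hg⟩ := ih
    exact ⟨r • c, fun S hS => by simp [hc S hS], fun x => by
      simp [hg, Finset.mul_sum, mul_assoc]⟩

/-- A function of degree at most `|M|` with a non-zero coefficient at `M` is not identically zero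
on any subcube whose free coordinates are those in `M`. -/
theorem exists_ne_zero_of_coeff_ne_zero [Fintype ι] [DecidableEq ι] {g : (ι → Bool) → ℝ}
    {c : Finset ι → ℝ} {M : Finset ι} (hc : ∀ S, M.card < S.card → c S = 0)
    (hg : ∀ x, g x = ∑ S, c S * monomialFun S x) (hM : c M ≠ 0) (x : ι → Bool) :
    ∃ y, (∀ i ∉ M, y i = x i) ∧ g y ≠ 0 := by
  by_contra! hzero
  let z : Finset ι → ι → Bool := fun U i => if i ∈ M then decide (i ∈ U) else x i
  -- The alternating sum over the subcube isolates `c M`: if `S` misses some `i ∈ M`, toggling `i`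
  -- in `U` cancels terms in pairs, and a proper superset of `M` has coefficient 0.
  have key : ∀ S, c S * ∑ U ∈ M.powerset, (-1 : ℝ) ^ U.card * monomialFun S (z U)
      = if S = M then c M * (-1) ^ M.card else 0 := by
    intro S
    split_ifs with hSM
    · subst hSM
      rw [Finset.sum_eq_single S]
      · have : monomialFun S (z S) = 1 := Finset.prod_eq_one fun i hi => by simp [z, hi, bit]
        rw [this, mul_one]
      · intro U hU hne
        obtain ⟨i, hi, hiU⟩ := Finset.exists_of_ssubset
          (Finset.ssubset_iff_subset_ne.2 ⟨Finset.mem_powerset.1 hU, hne⟩)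
        have : monomialFun S (z U) = 0 := Finset.prod_eq_zero hi (by simp [z, hi, hiU, bit])
        rw [this, mul_zero]
      · simp
    · by_cases hcard : M.card < S.card
      · simp [hc S hcard]
      · have hnot : ¬ M ⊆ S := fun h =>
          hSM (Finset.eq_of_subset_of_card_le h (not_lt.1 hcard)).symm
        obtain ⟨i, hiM, hiS⟩ := Finset.not_subset.1 hnot
        have hinv : ∀ U, monomialFun S (z (insert i U)) = monomialFun S (z U) := by
          intro U
          refine Finset.prod_congr rfl fun j hj => ?_
          have : j ≠ i := fun h => hiS (h ▸ hj)
          simp [z, this]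
        rw [← Finset.insert_erase hiM, Finset.sum_powerset_insert (Finset.notMem_erase i M),
          ← Finset.sum_add_distrib, Finset.sum_eq_zero, mul_zero]
        intro U hU
        have hiU : i ∉ U := fun h => Finset.notMem_erase i M (Finset.mem_powerset.1 hU h)
        rw [hinv, Finset.card_insert_of_notMem hiU]
        ring
  have hsum : ∑ U ∈ M.powerset, (-1 : ℝ) ^ U.card * g (z U) = 0 :=
    Finset.sum_eq_zero fun U _ => by
      rw [hzero (z U) fun i hi => by simp [z, hi], mul_zero]
  have hswap : ∑ U ∈ M.powerset, (-1 : ℝ) ^ U.card * g (z U)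
      = ∑ S, c S * ∑ U ∈ M.powerset, (-1 : ℝ) ^ U.card * monomialFun S (z U) := by
    simp_rw [hg, Finset.mul_sum]
    rw [Finset.sum_comm]
    exact Finset.sum_congr rfl fun _ _ => Finset.sum_congr rfl fun _ _ => by ring
  rw [hswap, Finset.sum_congr rfl fun S _ => key S] at hsum
  simp [hM] at hsum

/-- Fixing the coordinates in a set that meets all monomials of degree `d + 1` lowers the
degree. -/
theorem piecewise_mem_lowDegree [Fintype ι] [DecidableEq ι] {d : ℕ} {g : (ι → Bool) → ℝ}
    {c : Finset ι → ℝ} (hc : ∀ S, d + 1 < S.card → c S = 0)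
    (hg : ∀ x, g x = ∑ S, c S * monomialFun S x) {A : Finset ι}
    (hA : ∀ S, S.card = d + 1 → c S ≠ 0 → ¬ Disjoint S A) (a : ι → Bool) :
    (fun x => g (A.piecewise a x)) ∈ lowDegree ι d := by
  have h : (fun x => g (A.piecewise a x))
      = ∑ S, c S • fun x => monomialFun S (A.piecewise a x) := by
    funext x
    simp [hg, Finset.sum_apply]
  rw [h]
  refine sum_mem fun S _ => ?_
  by_cases hcS : c S = 0
  · simp [hcS]
  refine Submodule.smul_mem _ _ ?_
  rw [monomialFun_comp]
  -- A fixed coordinate is a constant and counts 0 towards the degree.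
  refine lowDegree_mono ?_ (prod_mem_lowDegree S (fun i => if i ∈ A then 0 else 1) _ fun i _ => ?_)
  · rw [Finset.sum_ite, Finset.sum_const_zero, zero_add, Finset.sum_const, smul_eq_mul, mul_one]
    have hle : S.card ≤ d + 1 := not_lt.1 fun hlt => hcS (hc S hlt)
    have hle' : (S.filter (· ∉ A)).card ≤ S.card := Finset.card_filter_le _ _
    rcases hle.lt_or_eq with hlt | heq
    · omega
    · obtain ⟨i, hiS, hiA⟩ := Finset.not_disjoint_iff.1 (hA S heq hcS)
      have : (S.filter (· ∉ A)).card < S.card :=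
        Finset.card_lt_card (Finset.filter_ssubset.2 ⟨i, hiS, by simpa using hiA⟩)
      omega
  · by_cases hi : i ∈ A
    · simpa [hi] using const_mem_lowDegree (bit (a i)) 0
    · simpa [hi] using bit_mem_lowDegree i

end LowDegree

/-! ### Markov's inequality and symmetrization -/

section Markov

/-- Markov's inequality at an endpoint of the interval `[0, 1]`. -/
theorem neg_coeff_one_le_of_forall_abs_le_one {e : ℕ} {s : ℝ[X]} (hdeg : s.natDegree ≤ e)
    (hs : ∀ t ∈ Set.Icc (0 : ℝ) 1, |s.eval t| ≤ 1) : -s.coeff 1 ≤ 2 * (e : ℝ) ^ 2 := by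
  -- This maps `[-1, 1]` onto `[0, 1]` and 1 to 0, where the Chebyshev bound `T_e'(1) = e²` applies;
  -- its slope `-1/2` produces the factor 2.
  let l : ℝ[X] := C (1 / 2) - C (1 / 2) * X
  have hl : l.natDegree ≤ 1 := by
    simp only [l]
    compute_degree
  have hP : (s.comp l).degree ≤ (e : WithBot ℕ) := by
    refine natDegree_le_iff_degree_le.1 (natDegree_comp_le.trans ?_)
    calc s.natDegree * l.natDegree ≤ e * 1 := Nat.mul_le_mul hdeg hl
      _ = e := mul_one e
  have hbd : ∀ x ∈ Set.Icc (-1 : ℝ) 1, |(s.comp l).eval x| ≤ 1 := by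
    intro x hx
    rw [eval_comp]
    refine hs _ ?_
    simp only [l, eval_sub, eval_mul, eval_C, eval_X, Set.mem_Icc] at hx ⊢
    constructor <;> linarith [hx.1, hx.2]
  have h := Chebyshev.eval_iterate_derivative_le_of_forall_abs_le_one (k := 1) le_rfl hP hbd
  have hT : (derivative (Chebyshev.T ℝ e)).eval 1 = (e : ℝ) ^ 2 := by
    rw [Chebyshev.T_derivative_eq_U]
    simp [sq]
  have hD : (derivative (s.comp l)).eval 1 = -s.coeff 1 / 2 := by
    have h1 : (derivative s).eval 0 = s.coeff 1 := by
      rw [← coeff_zero_eq_eval_zero, coeff_derivative]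
      simp
    simp [derivative_comp, l, h1, eval_comp]
    ring
  simp only [Function.iterate_one, hT, hD] at h
  linarith

variable {κ : Type*} [Fintype κ] [DecidableEq κ]

/-- The expectation of a monomial at a random point whose bits are independent and equal to `1`
with probability `t`. -/
theorem sum_prod_mul_monomialFun (T : Finset κ) (t : ℝ) :
    ∑ A : κ → Bool, (∏ k, if A k then t else 1 - t) * monomialFun T A = t ^ T.card := by
  have h : ∀ A : κ → Bool, (∏ k, if A k then t else 1 - t) * monomialFun T A
      = ∏ k, ((if A k then t else 1 - t) * if k ∈ T then bit (A k) else 1) := by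
    intro A
    rw [Finset.prod_mul_distrib, monomialFun]
    simp [Finset.prod_ite_mem]
  simp_rw [h]
  rw [← Fintype.prod_sum fun (k : κ) (b : Bool) =>
    (if b then t else 1 - t) * if k ∈ T then bit b else 1]
  have h' : ∀ k, ∑ b : Bool, ((if b then t else 1 - t) * if k ∈ T then bit b else 1)
      = if k ∈ T then t else 1 := by
    intro k
    split_ifs <;> simp [bit]
  simp_rw [h']
  simp [Finset.prod_ite_mem]

/-- A function of degree at most `e` with values in `[-1, 1]` that is `1` at a point of the cube
and `0` at all its neighbours lives on a cube of dimension at most `2e²`. -/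
theorem card_le_of_mem_lowDegree {e : ℕ} {Q : (κ → Bool) → ℝ} (hQ : Q ∈ lowDegree κ e)
    (hbd : ∀ A, |Q A| ≤ 1) (h0 : Q (fun _ => false) = 1)
    (h1 : ∀ k, Q (Function.update (fun _ => false) k true) = 0) :
    Fintype.card κ ≤ 2 * e ^ 2 := by
  obtain ⟨c, hc, hQc⟩ := exists_coeff_of_mem_lowDegree hQ
  -- The expectation of `Q` when each bit is independently 1 with probability `X`.
  let s : ℝ[X] := ∑ T, C (c T) * X ^ T.card
  have hdeg : s.natDegree ≤ e := by
    refine natDegree_sum_le_of_forall_le _ _ fun T _ => ?_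
    by_cases hT : e < T.card
    · simp [hc T hT]
    · exact (natDegree_C_mul_X_pow_le _ _).trans (not_lt.1 hT)
  have heval : ∀ t : ℝ, s.eval t = ∑ A : κ → Bool, (∏ k, if A k then t else 1 - t) * Q A := by
    intro t
    simp_rw [hQc, Finset.mul_sum]
    rw [Finset.sum_comm, eval_finsetSum]
    refine Finset.sum_congr rfl fun T _ => ?_
    simp_rw [mul_left_comm _ (c T)]
    rw [← Finset.mul_sum, sum_prod_mul_monomialFun]
    simp
  have hs : ∀ t ∈ Set.Icc (0 : ℝ) 1, |s.eval t| ≤ 1 := by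
    intro t ht
    rw [heval]
    have hw : ∀ A : κ → Bool, 0 ≤ ∏ k, if A k then t else 1 - t := fun A =>
      Finset.prod_nonneg fun k _ => by split_ifs <;> linarith [ht.1, ht.2]
    have htot := sum_prod_mul_monomialFun (∅ : Finset κ) t
    simp only [monomialFun, Finset.prod_empty, mul_one, Finset.card_empty, pow_zero] at htot
    refine (Finset.abs_sum_le_sum_abs _ _).trans
      ((Finset.sum_le_sum fun A _ => ?_).trans_eq htot)
    rw [abs_mul, abs_of_nonneg (hw A)]
    exact mul_le_of_le_one_right (hw A) (hbd A)
  have hc0 : c ∅ = 1 := by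
    rw [← h0, hQc, Finset.sum_eq_single ∅]
    · simp [monomialFun]
    · intro T _ hT
      obtain ⟨k, hk⟩ := Finset.nonempty_iff_ne_empty.2 hT
      rw [monomialFun, Finset.prod_eq_zero hk (by simp [bit]), mul_zero]
    · simp
  -- The coefficient at `{k}` is the value at the `k`-th neighbour minus the value at the origin.
  have hc1 : ∀ k, c {k} = -1 := by
    intro k
    have h := h1 k
    rw [hQc, ← Finset.sum_subset (Finset.subset_univ {∅, {k}}), Finset.sum_pair (by simp)] at h
    · simp [monomialFun, bit, hc0] at h
      linarith
    · intro T _ hT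
      have : ∃ l ∈ T, l ≠ k := by
        by_contra! hall
        rcases Finset.subset_singleton_iff.1 fun l hl => Finset.mem_singleton.2 (hall l hl)
          with h | h <;> simp [h] at hT
      obtain ⟨l, hl, hlk⟩ := this
      rw [monomialFun, Finset.prod_eq_zero hl (by simp [bit, hlk]), mul_zero]
  have hcoeff : s.coeff 1 = -(Fintype.card κ : ℝ) := by
    have h : s.coeff 1 = ∑ T ∈ (Finset.univ : Finset κ).powersetCard 1, c T := by
      simp only [s, finsetSum_coeff, coeff_C_mul, coeff_X_pow, Finset.powersetCard_eq_filter,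
        Finset.powerset_univ, Finset.sum_filter, mul_ite, mul_one, mul_zero, eq_comm]
    rw [h, Finset.powersetCard_one, Finset.sum_map]
    simp [hc1]
  have h := neg_coeff_one_le_of_forall_abs_le_one hdeg hs
  rw [hcoeff, neg_neg] at h
  exact_mod_cast h

end Markov

/-! ### Disjoint blocks -/

/-- A family of finite sets has a pairwise disjoint subfamily whose union meets every non-empty
member of the family. -/
theorem exists_pairwiseDisjoint_hitting {ι : Type*} [DecidableEq ι] (𝓜 : Finset (Finset ι)) :
    ∃ 𝓕 : Finset (Finset ι), 𝓕 ⊆ 𝓜 ∧ (𝓕 : Set (Finset ι)).PairwiseDisjoint id ∧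
      ∀ S ∈ 𝓜, S.Nonempty → ¬ Disjoint S (𝓕.biUnion id) := by
  classical
  obtain ⟨𝓕, hmax⟩ := Finset.exists_maximal
    (s := 𝓜.powerset.filter fun 𝓕 : Finset (Finset ι) =>
      (𝓕 : Set (Finset ι)).PairwiseDisjoint id)
    ⟨∅, by simp⟩
  have hmem := Finset.mem_filter.1 hmax.prop
  refine ⟨𝓕, Finset.mem_powerset.1 hmem.1, hmem.2, fun S hS hne hdis => ?_⟩
  have hdis' : ∀ T ∈ 𝓕, Disjoint S T := fun T hT =>
    hdis.mono_right (Finset.subset_biUnion_of_mem id hT)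
  -- A missed `S` could be adjoined, so by maximality it already lies in `𝓕` and is disjoint from
  -- itself.
  have hins : insert S 𝓕 ≤ 𝓕 := by
    refine hmax.le_of_ge (Finset.mem_filter.2 ⟨?_, ?_⟩) (Finset.subset_insert S 𝓕)
    · exact Finset.mem_powerset.2 (Finset.insert_subset hS (Finset.mem_powerset.1 hmem.1))
    · rw [Finset.coe_insert]
      exact hmem.2.insert fun T hT _ => hdis' T hT
  have := hdis' S (hins (Finset.mem_insert_self S 𝓕))
  exact hne.ne_empty (disjoint_self.1 this)

/-- Disjoint sets such that a function of degree at most `e` can be annihilated by changing the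
bits of any one of them number at most `2e²`. -/
theorem card_le_of_pairwiseDisjoint {ι : Type*} [Fintype ι] [DecidableEq ι] {e : ℕ}
    {h : (ι → Bool) → ℝ} (hh : h ∈ lowDegree ι e) (hne : ∃ x, h x ≠ 0) {𝓕 : Finset (Finset ι)}
    (hdis : (𝓕 : Set (Finset ι)).PairwiseDisjoint id)
    (hzero : ∀ S ∈ 𝓕, ∀ x : ι → Bool, ∃ y : ι → Bool, (∀ i ∉ S, y i = x i) ∧ h y = 0) : 𝓕.card ≤ 2 * e ^ 2 := by
  classical
  -- Dividing by the value of largest modulus gives the bound 1, although `h` is not Boolean.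
  obtain ⟨x, hx⟩ := Finite.exists_max fun x => |h x|
  have hx0 : 0 < |h x| := by
    obtain ⟨w, hw⟩ := hne
    exact (abs_pos.2 hw).trans_le (hx w)
  choose! y hy hhy using fun S hS => hzero S hS x
  -- Bit `S` of `A` decides whether block `S` is taken from `y S` or from `x`. Each output bit is
  -- affine in at most one bit of `A`, so composing with `φ` does not raise the degree.
  let φ : (𝓕 → Bool) → ι → Bool := fun A i =>
    if hi : ∃ S : 𝓕, i ∈ S.1 then (if A hi.choose then y hi.choose i else x i) else x i
  have hφ_mem : ∀ A (S : 𝓕) i, i ∈ S.1 → φ A i = if A S then y S i else x i := by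
    intro A S i hi
    have hex : ∃ S : 𝓕, i ∈ S.1 := ⟨S, hi⟩
    have hS : hex.choose = S := by
      by_contra hne'
      have := hdis hex.choose.2 S.2 fun h' => hne' (Subtype.ext h')
      exact Finset.disjoint_left.1 this hex.choose_spec hi
    simp only [φ, dif_pos hex, hS]
  have hφ_notMem : ∀ A i, (¬ ∃ S : 𝓕, i ∈ S.1) → φ A i = x i := fun A i hi => by
    simp only [φ, dif_neg hi]
  have hφ : ∀ i, (fun A => bit (φ A i)) ∈ lowDegree 𝓕 1 := by
    intro i
    by_cases hi : ∃ S : 𝓕, i ∈ S.1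
    · obtain ⟨S, hS⟩ := hi
      have : (fun A => bit (φ A i))
          = (fun _ => bit (x i)) + (bit (y S i) - bit (x i)) • fun A : 𝓕 → Bool => bit (A S) := by
        funext A
        rw [hφ_mem A S i hS]
        cases hA : A S <;> simp [bit, hA]
      rw [this]
      exact add_mem (const_mem_lowDegree _ _) (Submodule.smul_mem _ _ (bit_mem_lowDegree S))
    · simp_rw [hφ_notMem _ i hi]
      exact const_mem_lowDegree _ _
  have hφ0 : φ (fun _ => false) = x := by
    funext i
    by_cases hi : ∃ S : 𝓕, i ∈ S.1
    · obtain ⟨S, hS⟩ := hi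
      simp [hφ_mem _ S i hS]
    · exact hφ_notMem (fun _ => false) i hi
  have hφ1 : ∀ S : 𝓕, φ (Function.update (fun _ => false) S true) = y S := by
    intro S
    funext i
    by_cases hi : ∃ T : 𝓕, i ∈ T.1
    · obtain ⟨T, hT⟩ := hi
      rw [hφ_mem _ T i hT]
      by_cases hTS : T = S
      · simp [hTS]
      · have hiS : i ∉ S.1 := fun h' => Finset.disjoint_left.1
          (hdis T.2 S.2 fun h'' => hTS (Subtype.ext h'')) hT h'
        simp [hTS, hy S.1 S.2 i hiS]
    · rw [hφ_notMem _ i hi, hy S.1 S.2 i fun h' => hi ⟨S, h'⟩]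
  rw [← Fintype.card_coe]
  refine card_le_of_mem_lowDegree (Q := (h x)⁻¹ • fun A => h (φ A))
    (Submodule.smul_mem _ _ (comp_mem_lowDegree hh φ hφ)) (fun A => ?_) ?_ fun S => ?_
  · simp only [Pi.smul_apply, smul_eq_mul, abs_mul, abs_inv]
    rw [inv_mul_le_one₀ hx0]
    exact hx _
  · simp only [Pi.smul_apply, smul_eq_mul, hφ0]
    exact inv_mul_cancel₀ (abs_pos.1 hx0)
  · simp [hφ1, hhy S.1 S.2]

/-! ### Building the decision tree -/

variable {n : ℕ}

/-- Query the bits in `A`, then continue with a tree for the restricted function. -/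
theorem exists_decisionTree_of_piecewise {k : ℕ} (A : Finset (Fin n)) :
    ∀ f : (Fin n → Bool) → Bool,
      (∀ a, ∃ T : DecisionTree n, (∀ x, T.eval x = f (A.piecewise a x)) ∧ T.depth ≤ k) →
      ∃ T : DecisionTree n, (∀ x, T.eval x = f x) ∧ T.depth ≤ A.card + k := by
  induction A using Finset.induction_on with
  | empty =>
    intro f hf
    obtain ⟨T, hT, hd⟩ := hf fun _ => false
    exact ⟨T, by simpa using hT, by simpa using hd⟩
  | insert i A hi ih =>
    intro f hf
    have h : ∀ b, ∃ T : DecisionTree n,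
        (∀ x, T.eval x = f (Function.update x i b)) ∧ T.depth ≤ A.card + k := by
      intro b
      refine ih (fun x => f (Function.update x i b)) fun a => ?_
      obtain ⟨T, hT, hd⟩ := hf (Function.update a i b)
      refine ⟨T, fun x => ?_, hd⟩
      rw [hT]
      congr 1
      funext j
      by_cases hj : j = i
      · subst hj
        simp
      · by_cases hjA : j ∈ A <;> simp [Finset.piecewise, hj, hjA]
    obtain ⟨T₀, h₀, hd₀⟩ := h false
    obtain ⟨T₁, h₁, hd₁⟩ := h true
    refine ⟨.query i T₀ T₁, fun x => ?_, ?_⟩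
    · cases hx : x i
      · have hu : Function.update x i false = x := by rw [← hx, Function.update_eq_self]
        simp [DecisionTree.eval, hx, h₀, hu]
      · have hu : Function.update x i true = x := by rw [← hx, Function.update_eq_self]
        simp [DecisionTree.eval, hx, h₁, hu]
    · rw [Finset.card_insert_of_notMem hi, DecisionTree.depth]
      omega

/-- Induction on `d` with `e` kept fixed: each round of queries lowers the degree of `g` and does
not raise that of `h`. Restrictions stay functions on the full cube, so `n` never changes. -/
theorem exists_decisionTree_depth_le (e d : ℕ) : ∀ (f : (Fin n → Bool) → Bool)
    (g h : (Fin n → Bool) → ℝ), g ∈ lowDegree (Fin n) d → h ∈ lowDegree (Fin n) e →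
    (∀ x, g x ≠ 0 ↔ f x = true) → (∀ x, h x ≠ 0 ↔ f x = false) →
    ∃ T : DecisionTree n, (∀ x, T.eval x = f x) ∧ T.depth ≤ 2 * d ^ 2 * e ^ 2 := by
  induction d with
  | zero =>
    intro f g h hg _ hgf _
    obtain ⟨c, hc, hgc⟩ := exists_coeff_of_mem_lowDegree hg
    have hconst : ∀ x, g x = c ∅ := by
      intro x
      rw [hgc, Finset.sum_eq_single ∅]
      · simp [monomialFun]
      · intro S _ hS
        rw [hc S (Finset.card_pos.2 (Finset.nonempty_iff_ne_empty.2 hS)), zero_mul]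
      · simp
    refine ⟨.leaf (f fun _ => false), fun x => ?_, Nat.zero_le _⟩
    rw [DecisionTree.eval, Bool.eq_iff_iff, ← hgf, ← hgf, hconst, hconst]
  | succ d ih =>
    intro f g h hg hh hgf hhf
    -- The block bound normalizes by the maximum of `|h|`, so `h = 0` is treated apart; then `f` is
    -- constantly true.
    by_cases hne : ∃ x, h x ≠ 0
    swap
    · push Not at hne
      refine ⟨.leaf true, fun x => ?_, Nat.zero_le _⟩
      have := hhf x
      simp only [hne x, ne_eq, not_true, false_iff, Bool.not_eq_false] at this
      exact this.symm
    obtain ⟨c, hc, hgc⟩ := exists_coeff_of_mem_lowDegree hg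
    obtain ⟨𝓕, h𝓕, hdis, hhit⟩ := exists_pairwiseDisjoint_hitting
      (Finset.univ.filter fun S : Finset (Fin n) => S.card = d + 1 ∧ c S ≠ 0)
    have h𝓕' : ∀ S ∈ 𝓕, S.card = d + 1 ∧ c S ≠ 0 := fun S hS => (Finset.mem_filter.1 (h𝓕 hS)).2
    have hcard : 𝓕.card ≤ 2 * e ^ 2 := by
      refine card_le_of_pairwiseDisjoint hh hne hdis fun S hS x => ?_
      obtain ⟨y, hy, hgy⟩ := exists_ne_zero_of_coeff_ne_zero
        (fun T hT => hc T ((h𝓕' S hS).1 ▸ hT)) hgc (h𝓕' S hS).2 x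
      refine ⟨y, hy, ?_⟩
      by_contra hhy
      rw [hgf] at hgy
      rw [← ne_eq, hhf, hgy] at hhy
      exact Bool.noConfusion hhy
    have hA : (𝓕.biUnion id).card ≤ (2 * e ^ 2) * (d + 1) :=
      (Finset.card_biUnion_le_card_mul _ _ _ fun S hS => (h𝓕' S hS).1.le).trans
        (Nat.mul_le_mul_right _ hcard)
    obtain ⟨T, hT, hTd⟩ := exists_decisionTree_of_piecewise (k := 2 * d ^ 2 * e ^ 2)
      (𝓕.biUnion id) f fun a => by
        refine ih _ (fun x => g ((𝓕.biUnion id).piecewise a x))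
          (fun x => h ((𝓕.biUnion id).piecewise a x)) ?_ ?_ (fun x => hgf _) fun x => hhf _
        · refine piecewise_mem_lowDegree hc hgc (fun S hS hcS => hhit S ?_ ?_) a
          · exact Finset.mem_filter.2 ⟨Finset.mem_univ S, hS, hcS⟩
          · exact Finset.card_pos.1 (by omega)
        · refine comp_mem_lowDegree hh _ fun i => ?_
          by_cases hi : i ∈ 𝓕.biUnion id
          · simp only [Finset.piecewise_eq_of_mem _ _ _ hi]
            exact const_mem_lowDegree _ _
          · simp only [Finset.piecewise_eq_of_notMem _ _ _ hi]
            exact bit_mem_lowDegree i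
    refine ⟨T, hT, hTd.trans ?_⟩
    calc (𝓕.biUnion id).card + 2 * d ^ 2 * e ^ 2
        ≤ (2 * e ^ 2) * (d + 1) + 2 * d ^ 2 * e ^ 2 := by gcongr
      -- The added slack completes `d² + (d + 1)` to `(d + 1)²`.
      _ ≤ (2 * e ^ 2) * (d + 1) + 2 * d ^ 2 * e ^ 2 + 2 * e ^ 2 * d := Nat.le_add_right _ _
      _ = 2 * (d + 1) ^ 2 * e ^ 2 := by ring

theorem evalCube_mem_lowDegree (p : MvPolynomial (Fin n) ℝ) :
    evalCube p ∈ lowDegree (Fin n) p.totalDegree := by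
  have h : evalCube p = ∑ m ∈ p.support, p.coeff m • monomialFun m.support := by
    funext x
    simp only [evalCube, MvPolynomial.eval_eq, Finset.sum_apply, Pi.smul_apply, smul_eq_mul,
      monomialFun]
    refine Finset.sum_congr rfl fun m _ => congrArg _ (Finset.prod_congr rfl fun i hi => ?_)
    have := Finsupp.mem_support_iff.1 hi
    cases x i <;> simp [bit, this]
  rw [h]
  refine sum_mem fun m hm => Submodule.smul_mem _ _ (monomialFun_mem_lowDegree ?_)
  refine le_trans ?_ (MvPolynomial.le_totalDegree hm)
  rw [Finsupp.sum, Finset.card_eq_sum_ones]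
  exact Finset.sum_le_sum fun i hi => Nat.one_le_iff_ne_zero.2 (Finsupp.mem_support_iff.1 hi)

theorem D_le_two_mul_ndeg_sq_mul_ndeg_sq (f : (Fin n → Bool) → Bool) :
    D f ≤ 2 * ndeg f ^ 2 * ndeg (neg f) ^ 2 := by
  obtain ⟨p, hp, hpd⟩ := exists_ndeg f
  obtain ⟨q, hq, hqd⟩ := exists_ndeg (neg f)
  obtain ⟨T, hT, hTd⟩ := exists_decisionTree_depth_le _ _ f _ _ (evalCube_mem_lowDegree p)
    (evalCube_mem_lowDegree q) hp.2 fun x => by simpa [neg] using hq.2 x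
  rw [hpd, hqd] at hTd
  exact (Nat.sInf_le ⟨T, hT, rfl⟩ : D f ≤ T.depth).trans hTd

/-! ### Comparison with degree and rational degree -/

theorem isMultilinear_prod_X (S : Finset (Fin n)) :
    IsMultilinear (∏ i ∈ S, MvPolynomial.X i : MvPolynomial (Fin n) ℝ) := by
  rw [isMultilinear_iff_degreeOf]
  intro j
  refine (MvPolynomial.degreeOf_prod_le j S _).trans ?_
  simp only [MvPolynomial.degreeOf_X]
  rw [Finset.sum_ite_eq]
  split_ifs <;> simp

theorem exists_multilinear_of_mem_lowDegree {d : ℕ} {g : (Fin n → Bool) → ℝ}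
    (hg : g ∈ lowDegree (Fin n) d) :
    ∃ p, IsMultilinear p ∧ (∀ x, evalCube p x = g x) ∧ p.totalDegree ≤ d := by
  obtain ⟨c, hc, hgc⟩ := exists_coeff_of_mem_lowDegree hg
  refine ⟨∑ S, MvPolynomial.C (c S) * ∏ i ∈ S, MvPolynomial.X i, ?_, fun x => ?_, ?_⟩
  · rw [isMultilinear_iff_degreeOf]
    intro j
    refine (MvPolynomial.degreeOf_sum_le j _ _).trans (Finset.sup_le fun S _ => ?_)
    exact (MvPolynomial.degreeOf_C_mul_le _ j _).trans
      ((isMultilinear_iff_degreeOf _).1 (isMultilinear_prod_X S) j)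
  · simp [evalCube, hgc, monomialFun]
  · refine MvPolynomial.totalDegree_finsetSum_le fun S _ => ?_
    by_cases hS : d < S.card
    · simp [hc S hS]
    · refine (MvPolynomial.totalDegree_mul _ _).trans ?_
      rw [MvPolynomial.totalDegree_C, zero_add]
      refine (MvPolynomial.totalDegree_finsetProd _ _).trans ?_
      simpa using hS

/-- A query at `i` computes `T₀ + (T₁ - T₀) xᵢ`, so it costs one degree. -/
theorem DecisionTree.bit_eval_mem_lowDegree (T : DecisionTree n) :
    (fun x => bit (T.eval x)) ∈ lowDegree (Fin n) T.depth := by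
  induction T with
  | leaf b => exact const_mem_lowDegree (bit b) 0
  | query i T₀ T₁ h₀ h₁ =>
    have h : (fun x => bit ((DecisionTree.query i T₀ T₁).eval x))
        = (fun x => bit (T₀.eval x)) + ((fun x => bit (T₁.eval x)) - fun x => bit (T₀.eval x))
          * fun x => bit (x i) := by
      funext x
      cases hx : x i <;> simp [DecisionTree.eval, hx, bit]
    rw [h, DecisionTree.depth]
    have h₀' := lowDegree_mono (le_max_left T₀.depth T₁.depth) h₀
    have h₁' := lowDegree_mono (le_max_right T₀.depth T₁.depth) h₁
    exact add_mem (lowDegree_mono (Nat.le_succ _) h₀')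
      (mul_mem_lowDegree (sub_mem h₁' h₀') (bit_mem_lowDegree i))

theorem deg_le_D (f : (Fin n → Bool) → Bool) : deg f ≤ D f := by
  obtain ⟨T, hT, hTd⟩ := exists_D f
  obtain ⟨p, hp, hpe, hpd⟩ := exists_multilinear_of_mem_lowDegree T.bit_eval_mem_lowDegree
  have : multilinearRep f = p := (existsUnique_multilinear fun x => bit (f x)).unique
    (multilinearRep_spec f) ⟨hp, fun x => by rw [hpe, hT]⟩
  rw [deg, this, ← hTd]
  exact hpd

/-- The numerator equals `f q` on the cube, and `q` has no zero there. -/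
theorem ndeg_le_rdeg (f : (Fin n → Bool) → Bool) : ndeg f ≤ rdeg f := by
  obtain ⟨p, q, ⟨hp, _, h⟩, hd⟩ := exists_rdeg f
  have hrep : IsNondetRep f p := ⟨hp, fun x => by
    obtain ⟨hqx, hpq⟩ := h x
    rw [div_eq_iff hqx] at hpq
    cases hf : f x <;> simp [hpq, hf, bit, hqx]⟩
  exact (Nat.sInf_le ⟨p, hrep, rfl⟩ : ndeg f ≤ p.totalDegree).trans (hd ▸ le_max_left _ _)

/-- On the cube `q - p = (1 - f) q`, which is nonzero exactly where `f = 0`. -/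
theorem ndeg_neg_le_rdeg (f : (Fin n → Bool) → Bool) : ndeg (neg f) ≤ rdeg f := by
  obtain ⟨p, q, ⟨hp, hq, h⟩, hd⟩ := exists_rdeg f
  have hrep : IsNondetRep (neg f) (q - p) := by
    refine ⟨?_, fun x => ?_⟩
    · rw [isMultilinear_iff_degreeOf] at hp hq ⊢
      exact fun i => (MvPolynomial.degreeOf_sub_le i q p).trans (max_le (hq i) (hp i))
    · obtain ⟨hqx, hpq⟩ := h x
      rw [div_eq_iff hqx] at hpq
      have hsub : evalCube (q - p) x = evalCube q x - evalCube p x := map_sub _ _ _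
      rw [hsub, hpq]
      cases hf : f x <;> simp [neg, hf, bit, hqx]
  refine (Nat.sInf_le ⟨q - p, hrep, rfl⟩ : ndeg (neg f) ≤ (q - p).totalDegree).trans ?_
  exact (MvPolynomial.totalDegree_sub q p).trans (by rw [← hd, max_comm])

end BoolFun

theorem mainTheorem1 (n : ℕ) (f : (Fin n → Bool) → Bool) :
    BoolFun.deg f ≤ BoolFun.D f ∧
    BoolFun.D f ≤ 2 * BoolFun.ndeg f ^ 2 * BoolFun.ndeg (BoolFun.neg f) ^ 2 ∧
    2 * BoolFun.ndeg f ^ 2 * BoolFun.ndeg (BoolFun.neg f) ^ 2 ≤ 2 * BoolFun.rdeg f ^ 4 := by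
  refine ⟨BoolFun.deg_le_D f, BoolFun.D_le_two_mul_ndeg_sq_mul_ndeg_sq f, ?_⟩
  calc 2 * BoolFun.ndeg f ^ 2 * BoolFun.ndeg (BoolFun.neg f) ^ 2
      ≤ 2 * BoolFun.rdeg f ^ 2 * BoolFun.rdeg f ^ 2 := by
        gcongr
        · exact BoolFun.ndeg_le_rdeg f
        · exact BoolFun.ndeg_neg_le_rdeg f
    _ = 2 * BoolFun.rdeg f ^ 4 := by ring
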